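/- Let $\mathbb T=\mathbb R/\mathbb Z$ be the circle group and let $\mathfrak c=|\mathbb R|$. For an abelian group $G$ and a topological abelian group $K$, let $\mathrm{Hom}(G,K)$ be the set of all group homomorphisms $G\to K$ with the topology of pointwise convergence (the subspace topology from the product $K^G$), and let $\mathrm{Mono}(G,K)\subseteq\mathrm{Hom}(G,K)$ be the set of injective homomorphisms. Powers $\mathbb T^\kappa$ carry the product topology, and $\mathrm{Hom}(G,\mathbb T^{\kappa})$ is identified with $\widehat G^{\,\kappa}$, where $\widehat G=\mathrm{Hom}(G,\mathbb T)$. For $S\subseteq G$ put $$\mathbb D(S,K)=\{h\in\mathrm{Hom}(G,K): h(S)\text{ is dense in }K\}.$$ A topological space $X$ has the \emph{Baire property} if $\bigcap_{n\in\mathbb N}U_n$ is dense in $X$ for every sequence $(U_n)_{n\in\mathbb N}$ of dense open subsets of $X$. A subset $E\subseteq G$ is an \emph{almost $0$-torsion set} if $E$ is countably infinite and $\{x\in E: dx=g\}$ is finite for every $g\in G$ and every integer $d\ge 1$. \textbf{Theorem.} For a subset $S$ of an abelian group $G$, the following conditions are equivalent: (i) $\mathbb D(S,\mathbb T^\kappa)\neq\emptyset$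 for some cardinal $\kappa\ge 1$; (ii) $\mathbb D(S,\mathbb T^{\mathfrak c})$ is a dense subset of $\mathrm{Hom}(G,\mathbb T^{\mathfrak c})=\widehat G^{\,\mathfrak c}$ which, as a subspace, has the Baire property; (iii) $S$ contains an almost $0$-torsion set. If, in addition, $|G|\le 2^{\mathfrak c}$, then (i)--(iii) are also equivalent to: (iv) $\mathbb D(S,\mathbb T^{\mathfrak c})\cap\mathrm{Mono}(G,\mathbb T^{\mathfrak c})$ is a dense subset of $\mathrm{Hom}(G,\mathbb T^{\mathfrak c})=\widehat G^{\,\mathfrak c}$ which, as a subspace, has the Baire property. -/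

import Mathlib

open Cardinal

universe u v w

namespace KroneckerWeyl

/-- The topology of pointwise convergence on `Hom(G, K)`, i.e. the subspace topology inherited
from the Tychonoff product `K ^ G`. -/
instance homTopology {G : Type u} {K : Type v} [AddCommGroup G] [AddCommGroup K]
    [TopologicalSpace K] : TopologicalSpace (G →+ K) :=
  TopologicalSpace.induced (fun h : G →+ K => (h : G → K)) inferInstance

/-- `𝔻(S, K)`: the homomorphisms `h : G → K` such that `h(S)` is dense in `K`. -/
def denseHoms {G : Type u} [AddCommGroup G] (S : Set G) (K : Type v) [AddCommGroup K]
    [TopologicalSpace K] : Set (G →+ K) :=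
  {h | Dense (h '' S)}

/-- `Mono(G, K)`: the injective homomorphisms `G → K`. -/
def monoHoms (G : Type u) (K : Type v) [AddCommGroup G] [AddCommGroup K] : Set (G →+ K) :=
  {h | Function.Injective h}

/-- `d` is a proper divisor of `n`: `d ∉ {0, n}` and `d ∣ n`. In particular every positive `d`
is a proper divisor of `0`. -/
def IsProperDivisor (d n : ℕ) : Prop :=
  d ≠ 0 ∧ d ≠ n ∧ d ∣ n

/-- `E` is an almost `n`-torsion set in `G`: it is countably infinite, contained in `G[n]`, and
`{x ∈ E : d x = g}` is finite for every `g ∈ G` and every proper divisor `d` of `n`. -/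
structure IsAlmostTorsion {G : Type u} [AddCommGroup G] (n : ℕ) (E : Set G) : Prop where
  infinite : E.Infinite
  countable : E.Countable
  torsion : ∀ x ∈ E, n • x = 0
  finite_fiber : ∀ d : ℕ, IsProperDivisor d n → ∀ g : G, {x ∈ E | d • x = g}.Finite

/-- `A` is a dense subset of `X` which, as a topological space, has the Baire property: countable
intersections of dense open subsets of the space `A` are dense in `A`. -/
def IsDenseBaire {X : Type u} [TopologicalSpace X] (A : Set X) : Prop :=
  Dense A ∧ BaireSpace A

end KroneckerWeyl

/-!
Write `𝕋` for the circle, `Ĝ = Hom(G, 𝕋)` with the topology of pointwise convergence, and identify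
`Hom(G, 𝕋^C)` with `Ĝ^C`.

*An almost torsion set inside `S` from density of the image.* If some multiple `d • S` with `d ≥ 1`
is finite, then the image of `S` under a homomorphism to `𝕋` is not dense, because multiplication by
`d` maps dense sets of the circle to dense sets. Otherwise an almost `0`-torsion subset of `S` is
obtained by choosing `eₙ` with `n! • eₙ` different from `n! • eₘ` for all `m < n`
(`exists_isAlmostTorsion_of_forall_infinite`).

*Equidistribution.* Let `E` be almost `0`-torsion. The elements of `G` are orthonormal functions on
the compact group `Ĝ`, so by Bessel's inequality the integrals of `k • e` over an open set `O ⊆ Ĝ`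
tend to zero along `e ∈ E` for every `k ≠ 0`. By Weyl's criterion, the values `χ e` for `χ ∈ O`
equidistribute (`tendsto_setIntegral_apply`). In particular, `O` takes a value in a given arc at all
but finitely many `e ∈ E` (`finite_setOf_forall_apply_notMem`), and hence a generic point of `Ĝ^J`,
for finite `J`, maps `E` to an `ε`-dense subset of `𝕋^J`.

*Fusion.* A family of characters indexed by `C` maps `E` to a dense subset of `𝕋^C` as soon as all
finite subfamilies do so. As `C` has the cardinality of the continuum, it embeds in the Cantor
space, and a family as required can be built as in Mycielski's theorem on perfect independent sets,
by finite approximations that constrain the coordinates according to their first `n` binary digits.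
To meet dense open sets `V n` of `Ĝ^C` at the same time, at every stage finitely many coordinates
are split off and constrained individually (`Condition`). The outcome is `exists_generic_family`,
which gives density and the Baire property of the set of homomorphisms with dense image of `S`.

*Injectivity.* The construction only concerns the restrictions of the characters to a countable
subgroup `H`, and countably many of the characters separate the points of `H`. If `|G| ≤ 2^𝔠`, then
every subgroup of `G` embeds in `𝕋^𝔠` (`exists_injective_hom_of_le`); this and the divisibility of
the circle allow the other characters to be chosen outside `H` so that the whole family separates
the points of `G` (`exists_separating_family`).
-/

namespace KroneckerWeyl

open Set Filter Topology MeasureTheory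

/-! ### Characters and the topology of the dual group -/

section Characters

variable {G : Type u} [AddCommGroup G]

/-- The circle is divisible, hence injective: a homomorphism `f : A → 𝕋` that vanishes on the
kernel of `i : A → B` factors through `i`. -/
theorem exists_character_extension {A : Type v} {B : Type w} [AddCommGroup A] [AddCommGroup B]
    (i : A →+ B) (f : A →+ UnitAddCircle) (h : i.ker ≤ f.ker) :
    ∃ χ : B →+ UnitAddCircle, ∀ a, χ (i a) = f a := by
  obtain ⟨χ, hχ⟩ := (Module.Baer.of_divisible UnitAddCircle).extension_property_addMonoidHom
    (QuotientAddGroup.kerLift i) (QuotientAddGroup.kerLift_injective i)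
    (QuotientAddGroup.lift i.ker f h)
  exact ⟨χ, fun a => DFunLike.congr_fun hχ (a : A ⧸ i.ker)⟩

theorem exists_character_apply_ne_zero {g : G} (hg : g ≠ 0) :
    ∃ χ : G →+ UnitAddCircle, χ g ≠ 0 := by
  obtain ⟨χ, hχ⟩ := CharacterModule.exists_character_apply_ne_zero_of_ne_zero hg
  -- `CharacterModule` takes values in `ℚ/ℤ`, which embeds in `ℝ/ℤ`.
  let j : AddCircle (1 : ℚ) →+ UnitAddCircle :=
    QuotientAddGroup.map (AddSubgroup.zmultiples (1 : ℚ)) (AddSubgroup.zmultiples (1 : ℝ))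
      (Rat.castHom ℝ).toAddMonoidHom (by
        rintro _ ⟨n, rfl⟩
        exact ⟨n, by simp⟩)
  have hj : ∀ y : AddCircle (1 : ℚ), j y = 0 → y = 0 := by
    intro y hy
    induction y using QuotientAddGroup.induction_on with
    | H q =>
      have h' : ((q : ℝ) : UnitAddCircle) = 0 := hy
      obtain ⟨n, hn⟩ := (AddCircle.coe_eq_zero_iff (1 : ℝ)).1 h'
      refine (AddCircle.coe_eq_zero_iff (1 : ℚ)).2 ⟨n, ?_⟩
      have hn' : ((n • (1 : ℚ) : ℚ) : ℝ) = (q : ℝ) := by rw [← hn]; simp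
      exact_mod_cast hn'
  exact ⟨j.comp χ, fun h => hχ (hj _ h)⟩

theorem continuous_eval {K : Type v} [AddCommGroup K] [TopologicalSpace K] (g : G) :
    Continuous fun χ : G →+ K => χ g :=
  (continuous_apply g).comp continuous_induced_dom

theorem continuous_hom_iff {X : Type w} [TopologicalSpace X] {K : Type v} [AddCommGroup K]
    [TopologicalSpace K] {f : X → G →+ K} :
    Continuous f ↔ ∀ g, Continuous fun x => f x g :=
  continuous_induced_rng.trans continuous_pi_iff

theorem isClosedEmbedding_coe :
    IsClosedEmbedding (fun χ : G →+ UnitAddCircle => (χ : G → UnitAddCircle)) := by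
  refine ⟨⟨⟨rfl⟩, DFunLike.coe_injective⟩, ?_⟩
  have : range (fun χ : G →+ UnitAddCircle => (χ : G → UnitAddCircle)) =
      ⋂ (a : G) (b : G), {f | f (a + b) = f a + f b} := by
    ext f
    simp only [mem_range, mem_iInter, mem_ofPred_eq]
    constructor
    · rintro ⟨χ, rfl⟩ a b
      exact map_add χ a b
    · intro h
      exact ⟨AddMonoidHom.mk' f h, rfl⟩
  rw [this]
  exact isClosed_iInter fun a => isClosed_iInter fun b =>
    isClosed_eq (continuous_apply _) ((continuous_apply a).add (continuous_apply b))

instance compactSpace_character : CompactSpace (G →+ UnitAddCircle) :=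
  isClosedEmbedding_coe.compactSpace

instance isTopologicalAddGroup_character : IsTopologicalAddGroup (G →+ UnitAddCircle) where
  continuous_add := continuous_hom_iff.2 fun g =>
    ((continuous_eval g).comp continuous_fst).add ((continuous_eval g).comp continuous_snd)
  continuous_neg := continuous_hom_iff.2 fun g => (continuous_eval g).neg

/-- `Hom(G, 𝕋^C)` is the power `Ĝ^C` of the dual group. -/
def homPiHomeomorph (G : Type u) [AddCommGroup G] (C : Type v) :
    (G →+ (C → UnitAddCircle)) ≃ₜ (C → (G →+ UnitAddCircle)) where
  toFun h α := (Pi.evalAddMonoidHom (fun _ => UnitAddCircle) α).comp h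
  invFun x := AddMonoidHom.pi x
  left_inv _ := rfl
  right_inv _ := rfl
  continuous_toFun := continuous_pi fun α => continuous_hom_iff.2 fun g =>
    (continuous_apply α).comp (continuous_eval g)
  continuous_invFun := continuous_hom_iff.2 fun g => continuous_pi fun α =>
    (continuous_eval g).comp (continuous_apply α)

/-- The closed neighbourhood of `c` in the dual group formed by the characters that are `r`-close
to `c` on the finite set `Γ`. -/
def charBall (Γ : Finset G) (r : ℝ) (c : G →+ UnitAddCircle) : Set (G →+ UnitAddCircle) :=
  {χ | ∀ g ∈ Γ, dist (χ g) (c g) ≤ r}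

theorem mem_charBall_self (Γ : Finset G) {r : ℝ} (hr : 0 ≤ r) (c : G →+ UnitAddCircle) :
    c ∈ charBall Γ r c := fun g _ => by simpa using hr

theorem charBall_mono {Γ Γ' : Finset G} {r r' : ℝ} (hΓ : Γ ⊆ Γ') (hr : r' ≤ r)
    (c : G →+ UnitAddCircle) : charBall Γ' r' c ⊆ charBall Γ r c :=
  fun _ h g hg => (h g (hΓ hg)).trans hr

theorem isClosed_charBall (Γ : Finset G) (r : ℝ) (c : G →+ UnitAddCircle) :
    IsClosed (charBall Γ r c) := by
  simp only [charBall, ofPred_forall]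
  exact isClosed_biInter fun g _ => isClosed_le ((continuous_eval g).dist continuous_const)
    continuous_const

/-- The characters that are at distance `< r` from `c` on `Γ` form an open set. -/
theorem isOpen_setOf_dist_lt (Γ : Finset G) (r : ℝ) (c : G →+ UnitAddCircle) :
    IsOpen {χ : G →+ UnitAddCircle | ∀ g ∈ Γ, dist (χ g) (c g) < r} := by
  have : {χ : G →+ UnitAddCircle | ∀ g ∈ Γ, dist (χ g) (c g) < r} =
      ⋂ g ∈ Γ, {χ | dist (χ g) (c g) < r} := by ext; simp
  rw [this]
  exact isOpen_biInter_finset fun g _ => isOpen_lt ((continuous_eval g).dist continuous_const)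
    continuous_const

theorem exists_pos_forall_mem_le {A : Type v} (F : Finset A) {r : A → ℝ} (hr : ∀ a, 0 < r a) :
    ∃ r₀ > 0, ∀ a ∈ F, r₀ ≤ r a := by
  rcases F.eq_empty_or_nonempty with rfl | hne
  · exact ⟨1, one_pos, by simp⟩
  · exact ⟨F.inf' hne r, (Finset.lt_inf'_iff hne).2 fun g _ => hr g, fun g hg => Finset.inf'_le r hg⟩

theorem exists_charBall_subset {U : Set (G →+ UnitAddCircle)} (hU : IsOpen U)
    {c : G →+ UnitAddCircle} (hc : c ∈ U) : ∃ Γ : Finset G, ∃ r > 0, charBall Γ r c ⊆ U := by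
  obtain ⟨V, hV, rfl⟩ := isOpen_induced_iff.1 hU
  obtain ⟨Γ, t, ht, hsub⟩ := isOpen_pi_iff.1 hV _ hc
  have : ∀ g : G, ∃ r > 0, g ∈ Γ → Metric.closedBall (c g) r ⊆ t g := by
    intro g
    by_cases hg : g ∈ Γ
    · obtain ⟨r, hr, h⟩ := Metric.nhds_basis_closedBall.mem_iff.1 ((ht g hg).1.mem_nhds (ht g hg).2)
      exact ⟨r, hr, fun _ => h⟩
    · exact ⟨1, one_pos, fun h => absurd h hg⟩
  choose r hr hrt using this
  obtain ⟨r₀, hr₀, hr₀'⟩ := exists_pos_forall_mem_le Γ hr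
  exact ⟨Γ, r₀, hr₀, fun χ hχ => hsub fun g hg => hrt g hg ((hχ g hg).trans (hr₀' g hg))⟩

/-- Boxes of `charBall`s over finitely many coordinates, with a common `Γ` and `r`, form a
neighbourhood basis in `Ĝ^C`. -/
theorem exists_box_subset {C : Type v} {U : Set (C → (G →+ UnitAddCircle))} (hU : IsOpen U)
    {c : C → (G →+ UnitAddCircle)} (hc : c ∈ U) :
    ∃ F : Finset C, ∃ Γ : Finset G, ∃ r > 0, ∀ x : C → (G →+ UnitAddCircle),
      (∀ α ∈ F, x α ∈ charBall Γ r (c α)) → x ∈ U := by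
  classical
  obtain ⟨F, t, ht, hsub⟩ := isOpen_pi_iff.1 hU _ hc
  have : ∀ α : C, ∃ Γ : Finset G, ∃ r > 0, α ∈ F → charBall Γ r (c α) ⊆ t α := by
    intro α
    by_cases hα : α ∈ F
    · obtain ⟨Γ, r, hr, h⟩ := exists_charBall_subset (ht α hα).1 (ht α hα).2
      exact ⟨Γ, r, hr, fun _ => h⟩
    · exact ⟨∅, 1, one_pos, fun h => absurd h hα⟩
  choose Γ r hr hrt using this
  obtain ⟨r₀, hr₀, hr₀'⟩ := exists_pos_forall_mem_le F hr
  refine ⟨F, F.biUnion Γ, r₀, hr₀, fun x hx => hsub fun α hα => hrt α hα ?_⟩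
  exact charBall_mono (Finset.subset_biUnion_of_mem Γ hα) (hr₀' α hα) _ (hx α hα)

end Characters

/-! ### Equidistribution along almost torsion sets -/

section Equidistribution

variable {G : Type u} [AddCommGroup G]

/-- The dual group carries its Borel `σ`-algebra. -/
instance measurableSpace_character : MeasurableSpace (G →+ UnitAddCircle) := borel _

instance borelSpace_character : BorelSpace (G →+ UnitAddCircle) := ⟨rfl⟩

/-- The normalized Haar measure of the compact group `Ĝ`. -/
noncomputable def dualHaar (G : Type u) [AddCommGroup G] : Measure (G →+ UnitAddCircle) :=
  Measure.addHaarMeasure ⊤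

instance isAddHaarMeasure_dualHaar : (dualHaar G).IsAddHaarMeasure :=
  inferInstanceAs (Measure.addHaarMeasure _).IsAddHaarMeasure

instance isProbabilityMeasure_dualHaar : IsProbabilityMeasure (dualHaar G) where
  measure_univ := by
    simpa [dualHaar] using
      Measure.addHaarMeasure_self (K₀ := (⊤ : TopologicalSpace.PositiveCompacts
        (G →+ UnitAddCircle)))

/-- Evaluation at `g`, composed with `𝕋 ⊆ ℂ`: the character of `Ĝ` given by `g`. -/
noncomputable def evalChar (g : G) : C(G →+ UnitAddCircle, ℂ) where
  toFun χ := fourier 1 (χ g)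
  continuous_toFun := (fourier 1).continuous.comp (continuous_eval g)

theorem evalChar_zsmul (k : ℤ) (g : G) (χ : G →+ UnitAddCircle) :
    evalChar (k • g) χ = fourier k (χ g) := by
  simp [evalChar, fourier_apply]

theorem integral_evalChar {g : G} (hg : g ≠ 0) : ∫ χ, evalChar g χ ∂(dualHaar G) = 0 := by
  obtain ⟨θ, hθ⟩ := exists_character_apply_ne_zero hg
  have h : ∫ χ, evalChar g χ ∂(dualHaar G) =
      fourier 1 (θ g) * ∫ χ, evalChar g χ ∂(dualHaar G) := by
    rw [← integral_const_mul, ← integral_add_left_eq_self (μ := dualHaar G) _ θ]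
    refine integral_congr_ae (Eventually.of_forall fun χ => ?_)
    simp [evalChar, fourier_apply, AddCircle.toCircle_add]
  have hne : fourier 1 (θ g) ≠ (1 : ℂ) := by
    intro h1
    apply hθ
    rw [fourier_one] at h1
    have : AddCircle.toCircle (θ g) = AddCircle.toCircle (0 : UnitAddCircle) := by
      rw [AddCircle.toCircle_zero]; exact Circle.ext h1
    exact AddCircle.injective_toCircle one_ne_zero this
  by_contra h0
  exact hne (mul_right_cancel₀ h0 (by rw [one_mul]; exact h.symm))

/-- Distinct elements of `G` give orthogonal characters of `Ĝ`. -/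
theorem orthonormal_evalChar :
    Orthonormal ℂ fun g : G => ContinuousMap.toLp 2 (dualHaar G) ℂ (evalChar g) := by
  classical
  rw [orthonormal_iff_ite]
  intro g g'
  rw [ContinuousMap.inner_toLp]
  have h : ∀ χ, evalChar g' χ * (starRingEnd ℂ) (evalChar g χ) = evalChar (g' - g) χ := by
    intro χ
    simp only [evalChar, ContinuousMap.coe_mk, ← fourier_neg, map_sub]
    simp [fourier_apply, sub_eq_add_neg, AddCircle.toCircle_add]
  simp only [h]
  split_ifs with hg
  · subst hg
    simp [evalChar]
  · exact integral_evalChar (sub_ne_zero.2 (Ne.symm hg))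

/-- The Riemann-Lebesgue lemma on `Ĝ`. -/
theorem tendsto_setIntegral_evalChar {O : Set (G →+ UnitAddCircle)} (hO : MeasurableSet O) :
    Tendsto (fun g : G => ∫ χ in O, evalChar g χ ∂(dualHaar G)) cofinite (𝓝 0) := by
  have hs := (orthonormal_evalChar (G := G)).inner_products_summable
    (indicatorConstLp 2 hO (measure_ne_top (dualHaar G) O) (1 : ℂ))
  have h0 := hs.tendsto_cofinite_zero
  have h1 : Tendsto (fun g : G => ‖∫ χ in O, evalChar g χ ∂(dualHaar G)‖ ^ 2) cofinite (𝓝 0) := by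
    refine h0.congr fun g => ?_
    rw [norm_inner_symm, L2.inner_indicatorConstLp_one]
    congr 2
    exact integral_congr_ae (ae_restrict_of_ae (ContinuousMap.coeFn_toLp (dualHaar G) (evalChar g)))
  rw [tendsto_zero_iff_norm_tendsto_zero]
  simpa [Real.sqrt_sq] using h1.sqrt

open AddCircle in
/-- Weyl's criterion: if multiplication by every positive integer is finite-to-one on `E`, then
for every measurable `O ⊆ Ĝ` the image of the measure `dualHaar G` on `O` under evaluation at
`e ∈ E` tends weakly to a multiple of the Haar measure of the circle. -/
theorem tendsto_setIntegral_apply {E : Set G}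
    (hE : ∀ d : ℕ, d ≠ 0 → ∀ g : G, {x ∈ E | d • x = g}.Finite)
    {O : Set (G →+ UnitAddCircle)} (hO : MeasurableSet O) (φ : C(UnitAddCircle, ℂ)) :
    Tendsto (fun e : E => ∫ χ in O, φ (χ e) ∂(dualHaar G)) cofinite
      (𝓝 ((dualHaar G).real O * ∫ t, φ t ∂haarAddCircle)) := by
  have hint : ∀ (ψ : C(UnitAddCircle, ℂ)) (g : G),
      Integrable (fun χ : G →+ UnitAddCircle => ψ (χ g)) ((dualHaar G).restrict O) := by
    intro ψ g
    have : Continuous (fun χ : G →+ UnitAddCircle => ψ (χ g)) :=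
      ψ.continuous.comp (continuous_eval g)
    exact (this.integrable_of_hasCompactSupport (HasCompactSupport.of_compactSpace _)).restrict
  have hint' : ∀ ψ : C(UnitAddCircle, ℂ), Integrable ψ haarAddCircle := fun ψ =>
    ψ.continuous.integrable_of_hasCompactSupport (HasCompactSupport.of_compactSpace _)
  have hspan : ∀ ψ ∈ Submodule.span ℂ (range (fourier (T := 1))),
      Tendsto (fun e : E => ∫ χ in O, ψ (χ e) ∂(dualHaar G)) cofinite
      (𝓝 ((dualHaar G).real O * ∫ t, ψ t ∂haarAddCircle)) := by
    intro ψ hψ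
    induction hψ using Submodule.span_induction with
    | mem ψ h =>
      obtain ⟨k, rfl⟩ := h
      by_cases hk : k = 0
      · subst hk
        simp only [fourier_zero, integral_const, measureReal_restrict_apply_univ]
        simpa using tendsto_const_nhds
      · have hz : ∫ t, fourier k t ∂(haarAddCircle (T := 1)) = 0 := by
          have := (orthonormal_iff_ite.1 (orthonormal_fourier (T := 1))) 0 k
          rw [if_neg (Ne.symm hk), fourierLp, fourierLp, ContinuousMap.inner_toLp] at this
          simpa using this
        rw [hz, mul_zero]
        have hfin : Tendsto (fun e : E => k • (e : G)) cofinite cofinite := by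
          refine Tendsto.cofinite_of_finite_preimage_singleton fun g => ?_
          have h1 := hE k.natAbs (Int.natAbs_ne_zero.2 hk) g
          have h2 := hE k.natAbs (Int.natAbs_ne_zero.2 hk) (-g)
          refine Finite.subset ((h1.union h2).preimage Subtype.val_injective.injOn) ?_
          rintro ⟨e, he⟩ hek
          have hek' : k • e = g := hek
          rcases Int.natAbs_eq k with h | h
          · left
            refine ⟨he, ?_⟩
            rw [h, natCast_zsmul] at hek'
            exact hek'
          · right
            refine ⟨he, ?_⟩
            rw [h, neg_smul, natCast_zsmul] at hek'
            exact (neg_eq_iff_eq_neg.1 hek')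
        refine ((tendsto_setIntegral_evalChar hO).comp hfin).congr fun e => ?_
        simp only [Function.comp_apply, evalChar_zsmul]
    | zero => simpa using tendsto_const_nhds
    | add ψ₁ ψ₂ _ _ h₁ h₂ =>
      have := h₁.add h₂
      simp only [ContinuousMap.add_apply]
      rw [integral_add (hint' ψ₁) (hint' ψ₂), mul_add]
      refine this.congr fun e => ?_
      rw [integral_add (hint ψ₁ e) (hint ψ₂ e)]
    | smul c ψ _ h =>
      have := h.const_mul c
      simp only [ContinuousMap.smul_apply, smul_eq_mul, integral_const_mul]
      rwa [mul_left_comm]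
  rw [Metric.tendsto_nhds]
  intro ε hε
  have hφ : φ ∈ (Submodule.span ℂ (range (fourier (T := 1)))).topologicalClosure := by
    rw [span_fourier_closure_eq_top]; trivial
  obtain ⟨ψ, hψ, hdist⟩ := Metric.mem_closure_iff.1 hφ (ε / 3) (by positivity)
  have hnorm : ∀ t, ‖φ t - ψ t‖ ≤ ε / 3 := fun t => by
    rw [← dist_eq_norm]; exact (ContinuousMap.dist_apply_le_dist t).trans hdist.le
  have hμ : (dualHaar G).real O ≤ 1 := measureReal_le_one
  have hμ0 : 0 ≤ (dualHaar G).real O := measureReal_nonneg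
  filter_upwards [Metric.tendsto_nhds.1 (hspan ψ hψ) (ε / 3) (by positivity)] with e he
  have h1 : dist (∫ χ in O, φ (χ e) ∂(dualHaar G)) (∫ χ in O, ψ (χ e) ∂(dualHaar G)) ≤ ε / 3 := by
    rw [dist_eq_norm, ← integral_sub (hint φ e) (hint ψ e)]
    refine (norm_setIntegral_le_of_norm_le_const (measure_lt_top _ _)
      fun χ _ => hnorm (χ e)).trans ?_
    nlinarith
  have h2 : dist ((dualHaar G).real O * ∫ t, ψ t ∂haarAddCircle : ℂ)
      ((dualHaar G).real O * ∫ t, φ t ∂haarAddCircle) ≤ ε / 3 := by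
    rw [dist_comm, dist_eq_norm, ← mul_sub, ← integral_sub (hint' φ) (hint' ψ), norm_mul]
    have h3 : ‖∫ t, (φ t - ψ t) ∂(haarAddCircle (T := 1))‖ ≤ ε / 3 := by
      simpa using norm_integral_le_of_norm_le_const (μ := haarAddCircle (T := 1))
        (Eventually.of_forall hnorm)
    rw [Complex.norm_real, Real.norm_of_nonneg hμ0]
    nlinarith [norm_nonneg (∫ t, (φ t - ψ t) ∂(haarAddCircle (T := 1)))]
  calc _ ≤ _ := dist_triangle4 _ _ _ _
    _ < ε := by linarith

open AddCircle in
/-- For all but finitely many `e` in an almost torsion set, a given nonempty open set of characters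
takes a value in `V` at `e`. -/
theorem finite_setOf_forall_apply_notMem {E : Set G}
    (hE : ∀ d : ℕ, d ≠ 0 → ∀ g : G, {x ∈ E | d • x = g}.Finite)
    {O : Set (G →+ UnitAddCircle)} (hO : IsOpen O) (hne : O.Nonempty)
    {V : Set UnitAddCircle} (hV : IsOpen V) (hVne : V.Nonempty) :
    {e ∈ E | ∀ χ ∈ O, χ e ∉ V}.Finite := by
  obtain ⟨t₀, ht₀⟩ := hVne
  obtain ⟨f, hf0, hf1, hf⟩ := exists_continuous_zero_one_of_isClosed hV.isClosed_compl
    (isClosed_singleton (x := t₀)) (by simpa using ht₀)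
  let φ : C(UnitAddCircle, ℂ) := ⟨fun t => (f t : ℂ), Complex.continuous_ofReal.comp f.continuous⟩
  have hlim := tendsto_setIntegral_apply hE hO.measurableSet φ
  have hpos : 0 < ∫ t, f t ∂(haarAddCircle (T := 1)) :=
    f.continuous.integral_pos_of_hasCompactSupport_nonneg_nonzero
      (HasCompactSupport.of_compactSpace _) (fun t => (hf t).1)
      (x := t₀) (by rw [hf1 rfl]; exact one_ne_zero)
  have hOpos : 0 < (dualHaar G).real O :=
    ENNReal.toReal_pos (hO.measure_pos _ hne).ne' (measure_ne_top _ _)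
  have hlim0 : ((dualHaar G).real O * ∫ t, φ t ∂haarAddCircle : ℂ) ≠ 0 := by
    have : ∫ t, φ t ∂(haarAddCircle (T := 1)) = ((∫ t, f t ∂(haarAddCircle (T := 1)) : ℝ) : ℂ) :=
      integral_ofReal
    rw [this]
    exact mul_ne_zero (by exact_mod_cast hOpos.ne') (by exact_mod_cast hpos.ne')
  have hev := hlim.eventually_ne hlim0
  refine Finite.subset (Finite.image Subtype.val hev) ?_
  rintro e ⟨he, heV⟩
  refine ⟨⟨e, he⟩, ?_, rfl⟩
  simp only [mem_compl_iff, mem_ofPred_eq, not_not]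
  refine setIntegral_eq_zero_of_forall_eq_zero fun χ hχ => ?_
  simp [φ, hf0 (heV χ hχ)]

end Equidistribution

/-! ### Embedding abelian groups of size at most `2 ^ 𝔠` into `𝕋 ^ 𝔠` -/

section Embedding

variable {M : Type u} [AddCommGroup M]

/-- The cyclic subgroups generated by the elements of `X` form a direct sum. Elements of finite
order are allowed. -/
def IsIndepSet (X : Set M) : Prop :=
  ∀ c : M →₀ ℤ, ↑c.support ⊆ X → (c.sum fun x n => n • x) = 0 → ∀ x, c x • x = 0

theorem exists_maximal_isIndepSet : ∃ X : Set M, Maximal IsIndepSet X := by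
  refine zorn_subset {X : Set M | IsIndepSet X} fun S hS hchain => ?_
  rcases S.eq_empty_or_nonempty with rfl | hne
  · refine ⟨∅, fun c hc _ x => ?_, by simp⟩
    have : c = 0 := by simpa using hc
    simp [this]
  · refine ⟨⋃₀ S, fun c hc hsum => ?_, fun s hs => subset_sUnion_of_mem hs⟩
    obtain ⟨Y, hY, hcY⟩ := hchain.directedOn.exists_mem_subset_of_finset_subset_biUnion
      (f := id) hne (s := c.support) (by rwa [sUnion_eq_biUnion] at hc)
    exact hS hY c hcY hsum

/-- A maximal independent set generates an essential subgroup. -/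
theorem exists_zsmul_eq_sum_ne_zero {X : Set M} (hX : Maximal IsIndepSet X) {m : M} (hm : m ≠ 0) :
    ∃ (n : ℤ) (c : M →₀ ℤ), ↑c.support ⊆ X ∧ n • m = (c.sum fun x k => k • x) ∧ n • m ≠ 0 := by
  classical
  by_cases hmX : m ∈ X
  · refine ⟨1, Finsupp.single m 1, ?_, by simp, by simpa⟩
    exact (Finset.coe_subset.2 Finsupp.support_single_subset).trans (by simpa using hmX)
  · have hdep : ¬ IsIndepSet (insert m X) := fun h =>
      hmX (hX.2 h (subset_insert m X) (mem_insert m X))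
    simp only [IsIndepSet, not_forall] at hdep
    obtain ⟨c, hc, hsum, x, hx⟩ := hdep
    have hsplit : c m • m + ((c.erase m).sum fun x k => k • x) = 0 := by
      rw [← hsum]
      conv_rhs => rw [← Finsupp.single_add_erase m c]
      rw [Finsupp.sum_add_index' (by simp) (by intros; rw [add_smul]),
        Finsupp.sum_single_index (by simp)]
    have hsupp : ↑(c.erase m).support ⊆ X := by
      intro y hy
      rw [Finsupp.support_erase, Finset.coe_erase] at hy
      exact (hc hy.1).resolve_left hy.2
    have hne : c m • m ≠ 0 := by
      intro h0
      rw [h0, zero_add] at hsplit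
      have := hX.1 _ hsupp hsplit x
      by_cases hxm : x = m
      · exact hx (hxm ▸ h0)
      · rw [Finsupp.erase_ne hxm] at this
        exact hx this
    exact ⟨-c m, c.erase m, hsupp, by rw [neg_smul]; exact neg_eq_of_add_eq_zero_right hsplit,
      by rwa [neg_smul, neg_ne_zero]⟩

/-- Characters can be prescribed on an independent set, as long as the prescribed value at `x` is
the value at `x` of some character. -/
theorem IsIndepSet.exists_character {X : Set M} (hX : IsIndepSet X)
    (ι : M → (M →+ UnitAddCircle)) :
    ∃ χ : M →+ UnitAddCircle, ∀ x ∈ X, χ x = ι x x := by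
  classical
  obtain ⟨χ, hχ⟩ := exists_character_extension
    (Finsupp.liftAddHom (M := ℤ) fun x : X => (zmultiplesHom M) (x : M))
    (Finsupp.liftAddHom fun x : X => (zmultiplesHom UnitAddCircle) (ι x x)) (by
      intro c hc
      rw [AddMonoidHom.mem_ker] at hc ⊢
      have key := hX (c.mapDomain Subtype.val) (by
        intro y hy
        obtain ⟨x, -, rfl⟩ := Finset.mem_image.1 (Finsupp.mapDomain_support hy)
        exact x.2) (by
        rw [Finsupp.sum_mapDomain_index (by simp) (by intros; rw [add_smul])]
        exact hc)
      rw [Finsupp.liftAddHom_apply]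
      refine Finset.sum_eq_zero fun x _ => ?_
      have := key x
      change c x • ι (x : M) (x : M) = 0
      rw [Finsupp.mapDomain_apply Subtype.val_injective] at this
      rw [← map_zsmul, this, map_zero])
  refine ⟨χ, fun x hx => ?_⟩
  have := hχ (Finsupp.single ⟨x, hx⟩ 1)
  simpa using this

/-- A family of `|C|` characters separates the points of `M` if the elements of `M` can be labelled
by subsets of the infinite set `C`. Every test `(F, v, k)` with finite `v ⊆ F ⊆ C` gives a
character that lives on those members `x` of a maximal independent set whose label meets `F` in `v`
and that, if `k • x ≠ 0`, does not vanish there. -/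
theorem exists_injective_hom_of_le {C : Type v} [Infinite C]
    (hM : Cardinal.lift.{v} #M ≤ Cardinal.lift.{u} #(Set C)) :
    ∃ f : M →+ (C → UnitAddCircle), Function.Injective f := by
  classical
  obtain ⟨a⟩ := Cardinal.lift_mk_le'.1 hM
  obtain ⟨X, hX⟩ := exists_maximal_isIndepSet (M := M)
  have hι : ∀ (k : ℤ) (x : M), ∃ χ : M →+ UnitAddCircle, k • x ≠ 0 → χ (k • x) ≠ 0 := by
    intro k x
    by_cases h : k • x = 0
    · exact ⟨0, fun h' => absurd h h'⟩
    · obtain ⟨χ, hχ⟩ := exists_character_apply_ne_zero h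
      exact ⟨χ, fun _ => hχ⟩
  choose ι hι using hι
  have hχ : ∀ t : Finset C × Finset C × ℤ, ∃ χ : M →+ UnitAddCircle, ∀ x ∈ X,
      χ x = (if ∀ γ ∈ t.1, γ ∈ a x ↔ γ ∈ t.2.1 then ι t.2.2 x else 0) x := fun t =>
    hX.1.exists_character _
  choose χ hχ using hχ
  have hcard : #(Finset C × Finset C × ℤ) = #C := by
    simp only [Cardinal.mk_prod, Cardinal.lift_id, Cardinal.mk_finset_of_infinite, Cardinal.mk_int,
      Cardinal.lift_aleph0, Cardinal.lift_uzero]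
    rw [Cardinal.mul_aleph0_eq (Cardinal.aleph0_le_mk C),
      Cardinal.mul_eq_self (Cardinal.aleph0_le_mk C)]
  obtain ⟨e⟩ := Cardinal.eq.1 hcard.symm
  refine ⟨AddMonoidHom.pi fun γ => χ (e γ), (injective_iff_map_eq_zero _).2 fun m h0 => ?_⟩
  by_contra hm
  obtain ⟨n, c, hc, hn, hne⟩ := exists_zsmul_eq_sum_ne_zero hX hm
  obtain ⟨x₀, hx₀, hx₀'⟩ : ∃ x ∈ c.support, c x • x ≠ 0 := by
    by_contra! h
    exact hne (hn.trans (Finset.sum_eq_zero h))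
  -- a finite set that separates the label of `x₀` from the labels of the other `x ∈ c.support`
  have hsep : ∀ x, ∃ γ : C, x ≠ x₀ → ¬ (γ ∈ a x ↔ γ ∈ a x₀) := by
    intro x
    by_cases hx : x = x₀
    · exact ⟨Classical.arbitrary C, fun h => absurd hx h⟩
    · by_contra! h
      exact hx (a.injective (Set.ext fun γ => (h γ).2))
  choose sep hsep using hsep
  let F : Finset C := c.support.image sep
  let v : Finset C := F.filter fun γ => γ ∈ a x₀
  have h1 : χ (F, v, c x₀) (n • m) = 0 := by
    have := congrFun h0 (e.symm (F, v, c x₀))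
    simp only [AddMonoidHom.pi_apply, Equiv.apply_symm_apply, Pi.zero_apply] at this
    rw [map_zsmul, this, smul_zero]
  rw [hn, Finsupp.sum, map_sum, Finset.sum_eq_single x₀] at h1
  · rw [map_zsmul, hχ _ _ (hc hx₀), if_pos, ← map_zsmul] at h1
    · exact hι _ _ hx₀' h1
    · intro γ hγ
      simp [v, hγ]
  · intro x hx hxx
    rw [map_zsmul, hχ _ _ (hc hx), if_neg]
    · simp
    · intro h
      have hF : sep x ∈ F := Finset.mem_image_of_mem _ hx
      refine hsep x hxx ((h _ hF).trans ?_)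
      simp [v, hF]
  · exact fun h => absurd hx₀ h

end Embedding

/-! ### Finite powers of the dual group -/

section FinitePowers

variable {G : Type u} [AddCommGroup G] {E : Set G}

theorem isOpen_setOf_exists_dist_lt (E : Set G) {J : Type v} [Finite J] (y : J → UnitAddCircle)
    (ε : ℝ) :
    IsOpen {x : J → (G →+ UnitAddCircle) | ∃ e ∈ E, ∀ j, dist (x j e) (y j) < ε} := by
  have : {x : J → (G →+ UnitAddCircle) | ∃ e ∈ E, ∀ j, dist (x j e) (y j) < ε} =
      ⋃ e ∈ E, ⋂ j, {x | dist (x j e) (y j) < ε} := by ext; simp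
  rw [this]
  exact isOpen_biUnion fun e _ => isOpen_iInter_of_finite fun j =>
    isOpen_lt (((continuous_eval e).comp (continuous_apply j)).dist continuous_const)
      continuous_const

theorem dense_setOf_exists_dist_lt (hinf : E.Infinite)
    (hE : ∀ d : ℕ, d ≠ 0 → ∀ g : G, {x ∈ E | d • x = g}.Finite) {J : Type v} [Finite J]
    (y : J → UnitAddCircle) {ε : ℝ} (hε : 0 < ε) :
    Dense {x : J → (G →+ UnitAddCircle) | ∃ e ∈ E, ∀ j, dist (x j e) (y j) < ε} := by
  rw [dense_iff_inter_open]
  rintro U hU ⟨c, hc⟩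
  obtain ⟨u, hu, hsub⟩ := isOpen_pi_iff'.1 hU c hc
  have hbad : (⋃ j, {e ∈ E | ∀ χ ∈ u j, χ e ∉ Metric.ball (y j) ε}).Finite :=
    finite_iUnion fun j => finite_setOf_forall_apply_notMem hE (hu j).1 ⟨_, (hu j).2⟩
      Metric.isOpen_ball ⟨y j, Metric.mem_ball_self hε⟩
  obtain ⟨e, he, hgood⟩ := (hinf.sdiff hbad).nonempty
  have : ∀ j, ∃ χ ∈ u j, χ e ∈ Metric.ball (y j) ε := by
    intro j
    by_contra! h
    exact hgood (mem_iUnion.2 ⟨j, he, h⟩)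
  choose x hxu hxe using this
  exact ⟨x, hsub fun j _ => hxu j, e, he, hxe⟩

/-- Generic finite tuples of characters map `E` to an `ε`-dense subset of the torus. -/
theorem exists_isOpen_dense_forall_exists_dist_lt (hinf : E.Infinite)
    (hE : ∀ d : ℕ, d ≠ 0 → ∀ g : G, {x ∈ E | d • x = g}.Finite) (J : Type v) [Finite J]
    {ε : ℝ} (hε : 0 < ε) :
    ∃ U : Set (J → (G →+ UnitAddCircle)), IsOpen U ∧ Dense U ∧
      ∀ x ∈ U, ∀ y : J → UnitAddCircle, ∃ e ∈ E, ∀ j, dist (x j e) (y j) < ε := by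
  have := Fintype.ofFinite J
  obtain ⟨t, -, ht, hcov⟩ := Metric.finite_approx_of_totallyBounded
    (isCompact_univ (X := J → UnitAddCircle)).totallyBounded (ε / 2) (half_pos hε)
  have ho := fun y : J → UnitAddCircle => isOpen_setOf_exists_dist_lt E y (ε / 2)
  refine ⟨⋂ y ∈ t, {x | ∃ e ∈ E, ∀ j, dist (x j e) (y j) < ε / 2},
    ht.isOpen_biInter fun y _ => ho y, ?_, fun x hx y => ?_⟩
  · exact dense_biInter_of_isOpen (fun y _ => ho y) ht.countable
      fun y _ => dense_setOf_exists_dist_lt hinf hE y (half_pos hε)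
  · obtain ⟨y', hy', hyy'⟩ := mem_iUnion₂.1 (hcov (mem_univ y))
    obtain ⟨e, he, h⟩ := mem_iInter₂.1 hx y' hy'
    refine ⟨e, he, fun j => ?_⟩
    have h1 := (dist_le_pi_dist y y' j).trans_lt hyy'
    rw [dist_comm] at h1
    linarith [dist_triangle (x j e) (y' j) (y j), h j]

/-- If `C` is infinite, then a generic family of characters indexed by `C` does not vanish at a
given `g ≠ 0`. -/
theorem isOpen_and_dense_setOf_exists_apply_ne_zero (C : Type v) [Infinite C] {g : G} (hg : g ≠ 0) :
    IsOpen {x : C → (G →+ UnitAddCircle) | ∃ α, x α g ≠ 0} ∧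
      Dense {x : C → (G →+ UnitAddCircle) | ∃ α, x α g ≠ 0} := by
  classical
  constructor
  · have : {x : C → (G →+ UnitAddCircle) | ∃ α, x α g ≠ 0} = ⋃ α, {x | x α g ≠ 0} := by ext; simp
    rw [this]
    exact isOpen_iUnion fun α =>
      isOpen_ne_fun ((continuous_eval g).comp (continuous_apply α)) continuous_const
  · rw [dense_iff_inter_open]
    rintro U hU ⟨c, hc⟩
    obtain ⟨F, Γ, r, hr, hbox⟩ := exists_box_subset hU hc
    obtain ⟨α, hα⟩ := Infinite.exists_notMem_finset F
    obtain ⟨χ, hχ⟩ := exists_character_apply_ne_zero hg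
    refine ⟨Function.update c α χ, hbox _ fun β hβ => ?_, α, by simpa using hχ⟩
    rw [Function.update_of_ne (ne_of_mem_of_not_mem hβ hα)]
    exact mem_charBall_self _ hr.le _

end FinitePowers

/-! ### The fusion construction in `Ĝ ^ C` -/

section Fusion

variable {G : Type u} [AddCommGroup G] {C : Type v}

/-- A finite approximation to a family of characters indexed by `C`, where `C` is thought of as
a subset of the Cantor space. The coordinates in `F` are constrained individually; the other ones
are constrained only in terms of their first `n` binary digits, so that infinitely many of them
share a constraint. A constraint is a ball `charBall Γ r _`, centred at `atPoint α` for `α ∈ F` and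
at `atBranch t` for the coordinates outside `F` whose digit sequence is `t`. -/
structure Condition (G : Type u) [AddCommGroup G] (C : Type v) where
  F : Finset C
  n : ℕ
  Γ : Finset G
  r : ℝ
  r_pos : 0 < r
  atPoint : C → (G →+ UnitAddCircle)
  atBranch : (ℕ → Bool) → (G →+ UnitAddCircle)
  atBranch_congr : ∀ s t, (∀ i < n, s i = t i) → atBranch s = atBranch t

namespace Condition

/-- The families of characters that satisfy the constraints on the coordinates in `F`. -/
def box (p : Condition G C) : Set (C → (G →+ UnitAddCircle)) :=
  {x | ∀ α ∈ p.F, x α ∈ charBall p.Γ p.r (p.atPoint α)}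

open Classical in
/-- The constraint that `p` puts on the coordinate `α`, if `b` gives the binary digits of the
coordinates. -/
noncomputable def cell (p : Condition G C) (b : C → ℕ → Bool) (α : C) : Set (G →+ UnitAddCircle) :=
  charBall p.Γ p.r (if α ∈ p.F then p.atPoint α else p.atBranch (b α))

/-- `q` strengthens `p`. There is no relation between the constraint of `q` on a coordinate in
`q.F \ p.F` and the constraint of `p` on it. -/
structure Extends (q p : Condition G C) : Prop where
  F_subset : p.F ⊆ q.F
  n_le : p.n ≤ q.n
  Γ_subset : p.Γ ⊆ q.Γ
  atPoint : ∀ α ∈ p.F, charBall q.Γ q.r (q.atPoint α) ⊆ charBall p.Γ p.r (p.atPoint α)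
  atBranch : ∀ t, charBall q.Γ q.r (q.atBranch t) ⊆ charBall p.Γ p.r (p.atBranch t)

theorem Extends.refl (p : Condition G C) : p.Extends p :=
  ⟨subset_rfl, le_rfl, subset_rfl, fun _ _ => subset_rfl, fun _ => subset_rfl⟩

theorem Extends.trans {p q s : Condition G C} (h₁ : s.Extends q) (h₂ : q.Extends p) :
    s.Extends p :=
  ⟨h₂.F_subset.trans h₁.F_subset, h₂.n_le.trans h₁.n_le, h₂.Γ_subset.trans h₁.Γ_subset,
    fun α hα => (h₁.atPoint α (h₂.F_subset hα)).trans (h₂.atPoint α hα),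
    fun t => (h₁.atBranch t).trans (h₂.atBranch t)⟩

theorem Extends.box_subset {p q : Condition G C} (h : q.Extends p) : q.box ⊆ p.box :=
  fun _ hx α hα => h.atPoint α hα (hx α (h.F_subset hα))

theorem Extends.cell_subset {p q : Condition G C} (h : q.Extends p) (b : C → ℕ → Bool) {α : C}
    (hα : α ∈ q.F → α ∈ p.F) : q.cell b α ⊆ p.cell b α := by
  by_cases hq : α ∈ q.F
  · simpa [cell, hq, hα hq] using h.atPoint α (hα hq)
  · have hp : α ∉ p.F := fun hp => hq (h.F_subset hp)
    simpa [cell, hq, hp] using h.atBranch (b α)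

theorem cell_nonempty (p : Condition G C) (b : C → ℕ → Bool) (α : C) : (p.cell b α).Nonempty :=
  ⟨_, mem_charBall_self _ p.r_pos.le _⟩

theorem isClosed_cell (p : Condition G C) (b : C → ℕ → Bool) (α : C) : IsClosed (p.cell b α) :=
  isClosed_charBall _ _ _

theorem mem_cell_congr {p : Condition G C} {b : C → ℕ → Bool} {α : C} {χ ψ : G →+ UnitAddCircle}
    (h : ∀ g ∈ p.Γ, χ g = ψ g) (hψ : ψ ∈ p.cell b α) : χ ∈ p.cell b α :=
  fun g hg => by rw [h g hg]; exact hψ g hg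

/-- Every dense open set contains the box of some extension. -/
theorem exists_extends_box_subset (p : Condition G C) {V : Set (C → (G →+ UnitAddCircle))}
    (hV : IsOpen V) (hVd : Dense V) (k : ℕ) (Γ' : Finset G) :
    ∃ q : Condition G C, q.Extends p ∧ q.box ⊆ V ∧ k ≤ q.n ∧ Γ' ⊆ q.Γ := by
  classical
  let W : Set (C → (G →+ UnitAddCircle)) :=
    ⋂ α ∈ p.F, (fun x => x α) ⁻¹' {χ | ∀ g ∈ p.Γ, dist (χ g) (p.atPoint α g) < p.r}
  have hW : IsOpen W := isOpen_biInter_finset fun α _ =>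
    (isOpen_setOf_dist_lt p.Γ p.r (p.atPoint α)).preimage (continuous_apply α)
  have hWp : p.atPoint ∈ W := mem_iInter₂.2 fun α _ g _ => by simpa using p.r_pos
  obtain ⟨x₀, hxW, hxV⟩ := dense_iff_inter_open.1 hVd W hW ⟨_, hWp⟩
  obtain ⟨F₀, Γ₀, r₀, hr₀, hbox⟩ := exists_box_subset (hW.inter hV) ⟨hxW, hxV⟩
  let q : Condition G C :=
    { F := p.F ∪ F₀
      n := max p.n k
      Γ := p.Γ ∪ (Γ₀ ∪ Γ')
      r := min p.r r₀
      r_pos := lt_min p.r_pos hr₀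
      atPoint := x₀
      atBranch := p.atBranch
      atBranch_congr := fun s t h =>
        p.atBranch_congr s t fun i hi => h i (hi.trans_le (le_max_left _ _)) }
  have hΓ₀ : Γ₀ ⊆ q.Γ := Finset.subset_union_left.trans Finset.subset_union_right
  have hle : ∀ c, charBall q.Γ q.r c ⊆ charBall Γ₀ r₀ c := charBall_mono hΓ₀ (min_le_right _ _)
  refine ⟨q, ⟨Finset.subset_union_left, le_max_left _ _, Finset.subset_union_left, ?_, fun t =>
    charBall_mono Finset.subset_union_left (min_le_left _ _) _⟩, fun x hx => ?_, le_max_right _ _,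
    Finset.subset_union_right.trans Finset.subset_union_right⟩
  · intro α hα χ hχ
    have : Function.update x₀ α χ ∈ W := by
      refine (hbox _ fun β _ => ?_).1
      by_cases hβ : β = α
      · subst hβ
        simpa using hle _ hχ
      · rw [Function.update_of_ne hβ]
        exact mem_charBall_self _ hr₀.le _
    have := mem_iInter₂.1 this α hα
    simp only [mem_preimage, mem_ofPred_eq, Function.update_self] at this
    exact fun g hg => (this g hg).le
  · exact (hbox x fun α hα => hle _ (hx α (Finset.mem_union_right _ hα))).2

/-- Some extension with the same `F` and `n` forces `E` to be mapped to an `ε`-dense set by any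
finitely many coordinates outside `F` that have distinct initial segments of `n` digits, together
with any coordinates in `F`. -/
theorem exists_extends_forall_exists_dist_lt {E : Set G} (hinf : E.Infinite)
    (hE : ∀ d : ℕ, d ≠ 0 → ∀ g : G, {x ∈ E | d • x = g}.Finite) (b : C → ℕ → Bool)
    (p : Condition G C) {ε : ℝ} (hε : 0 < ε) :
    ∃ q : Condition G C, q.Extends p ∧
      ∀ (B : Finset C) (x : C → (G →+ UnitAddCircle)) (y : C → UnitAddCircle),
        (∀ α ∈ B, x α ∈ q.cell b α) →
        (∀ α ∈ B, ∀ β ∈ B, α ∉ q.F → β ∉ q.F → (∀ i < q.n, b α i = b β i) → α = β) →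
        ∃ e ∈ E, ∀ α ∈ B, dist (x α e) (y α) < ε := by
  classical
  let pad : (Fin p.n → Bool) → ℕ → Bool := fun w i => if h : i < p.n then w ⟨i, h⟩ else false
  -- the labels of the finitely many distinct constraints of `p`
  let J := p.F ⊕ (Fin p.n → Bool)
  let c : J → (G →+ UnitAddCircle) :=
    Sum.elim (fun α => p.atPoint α) fun w => p.atBranch (pad w)
  obtain ⟨U, hU, hUd, hUE⟩ := exists_isOpen_dense_forall_exists_dist_lt hinf hE J hε
  let W : Set (J → (G →+ UnitAddCircle)) :=
    ⋂ j, (fun x => x j) ⁻¹' {χ | ∀ g ∈ p.Γ, dist (χ g) (c j g) < p.r}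
  have hW : IsOpen W := isOpen_iInter_of_finite fun j =>
    (isOpen_setOf_dist_lt p.Γ p.r (c j)).preimage (continuous_apply j)
  have hWc : c ∈ W := mem_iInter.2 fun j g _ => by simpa using p.r_pos
  obtain ⟨x₀, hxW, hxU⟩ := dense_iff_inter_open.1 hUd W hW ⟨_, hWc⟩
  obtain ⟨F₀, Γ₀, r₀, hr₀, hbox⟩ := exists_box_subset (hW.inter hU) ⟨hxW, hxU⟩
  let q : Condition G C :=
    { F := p.F
      n := p.n
      Γ := p.Γ ∪ Γ₀
      r := min p.r r₀
      r_pos := lt_min p.r_pos hr₀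
      atPoint := fun α => if h : α ∈ p.F then x₀ (Sum.inl ⟨α, h⟩) else 0
      atBranch := fun t => x₀ (Sum.inr fun i => t i)
      atBranch_congr := fun s t h => by
        congr 2
        exact funext fun i => h i i.2 }
  have hle : ∀ c, charBall q.Γ q.r c ⊆ charBall Γ₀ r₀ c :=
    charBall_mono Finset.subset_union_right (min_le_right _ _)
  have hsub : ∀ j, charBall q.Γ q.r (x₀ j) ⊆ charBall p.Γ p.r (c j) := by
    intro j χ hχ
    have : Function.update x₀ j χ ∈ W := by
      refine (hbox _ fun β _ => ?_).1
      by_cases hβ : β = j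
      · subst hβ
        simpa using hle _ hχ
      · rw [Function.update_of_ne hβ]
        exact mem_charBall_self _ hr₀.le _
    have := mem_iInter.1 this j
    simp only [mem_preimage, mem_ofPred_eq, Function.update_self] at this
    exact fun g hg => (this g hg).le
  refine ⟨q, ⟨subset_rfl, le_rfl, Finset.subset_union_left, ?_, ?_⟩, fun B x y hx hB => ?_⟩
  · intro α hα
    simpa [q, c, hα] using hsub (Sum.inl ⟨α, hα⟩)
  · intro t
    have : p.atBranch t = p.atBranch (pad fun i => t i) :=
      p.atBranch_congr _ _ fun i hi => by simp [pad, hi]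
    rw [this]
    exact hsub (Sum.inr fun i => t i)
  · let label : C → J := fun α => if h : α ∈ p.F then Sum.inl ⟨α, h⟩ else Sum.inr fun i => b α i
    have hcell : ∀ α, q.cell b α = charBall q.Γ q.r (x₀ (label α)) := by
      intro α
      by_cases hα : α ∈ p.F <;> simp [cell, q, label, hα]
    have hinj : Function.Injective fun α : B => label α := by
      rintro ⟨α, hα⟩ ⟨β, hβ⟩ h
      by_cases hαF : α ∈ p.F <;> by_cases hβF : β ∈ p.F <;> simp [label, hαF, hβF] at h
      · have hαβ : α = β := congrArg Subtype.val (Sum.inl.inj h)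
        exact Subtype.ext hαβ
      · exact Subtype.ext (hB α hα β hβ hαF hβF fun i hi =>
          congrFun (Sum.inr.inj h) ⟨i, hi⟩)
    obtain ⟨e, he, h⟩ := hUE (Function.extend (fun α : B => label α) (fun α => x α) x₀) (by
      refine (hbox _ fun j _ => ?_).2
      by_cases hj : ∃ α : B, label α = j
      · obtain ⟨α, rfl⟩ := hj
        rw [hinj.extend_apply (fun α : B => x α) x₀ α]
        exact hle _ (hcell α ▸ hx α α.2)
      · rw [Function.extend_apply' _ _ _ hj]
        exact mem_charBall_self _ hr₀.le _)
      (Function.extend (fun α : B => label α) (fun α => y α) 0)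
    refine ⟨e, he, fun α hα => ?_⟩
    have := h (label α)
    rwa [hinj.extend_apply (fun α : B => x α) x₀ ⟨α, hα⟩,
      hinj.extend_apply (fun α : B => y α) 0 ⟨α, hα⟩] at this

/-- One step of the fusion. -/
theorem exists_extends_step [Infinite C] {E : Set G} (hinf : E.Infinite)
    (hE : ∀ d : ℕ, d ≠ 0 → ∀ g : G, {x ∈ E | d • x = g}.Finite) (b : C → ℕ → Bool)
    {V : Set (C → (G →+ UnitAddCircle))} (hV : IsOpen V) (hVd : Dense V) (k : ℕ)
    (p : Condition G C) :
    ∃ q : Condition G C, q.Extends p ∧ q.box ⊆ V ∧ k ≤ q.n ∧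
      (∀ g₁ ∈ p.Γ, ∀ g₂ ∈ p.Γ, g₁ - g₂ ∈ q.Γ) ∧
      (∀ x ∈ q.box, ∀ g ∈ p.Γ, g ≠ 0 → ∃ α, x α g ≠ 0) ∧
      ∀ (B : Finset C) (x : C → (G →+ UnitAddCircle)) (y : C → UnitAddCircle),
        (∀ α ∈ B, x α ∈ q.cell b α) →
        (∀ α ∈ B, ∀ β ∈ B, α ∉ q.F → β ∉ q.F → (∀ i < q.n, b α i = b β i) → α = β) →
        ∃ e ∈ E, ∀ α ∈ B, dist (x α e) (y α) < 1 / ((k : ℝ) + 1) := by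
  classical
  let V' : Set (C → (G →+ UnitAddCircle)) := V ∩ ⋂ g ∈ p.Γ.erase 0, {x | ∃ α, x α g ≠ 0}
  have ho : ∀ g ∈ p.Γ.erase 0, IsOpen {x : C → (G →+ UnitAddCircle) | ∃ α, x α g ≠ 0} :=
    fun g hg => (isOpen_and_dense_setOf_exists_apply_ne_zero C (Finset.ne_of_mem_erase hg)).1
  have hV' : IsOpen V' := hV.inter (isOpen_biInter_finset ho)
  have hVd' : Dense V' := hVd.inter_of_isOpen_left
    (dense_biInter_of_isOpen ho (p.Γ.erase 0).countable_toSet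
      fun g hg => (isOpen_and_dense_setOf_exists_apply_ne_zero C (Finset.ne_of_mem_erase hg)).2) hV
  obtain ⟨p₁, h₁, hbox, hn, hΓ⟩ := p.exists_extends_box_subset hV' hVd' k
    ((p.Γ ×ˢ p.Γ).image fun a => a.1 - a.2)
  obtain ⟨q, hq, hqE⟩ := p₁.exists_extends_forall_exists_dist_lt hinf hE b
    (Nat.one_div_pos_of_nat (n := k) (α := ℝ))
  refine ⟨q, hq.trans h₁, fun x hx => (hbox (hq.box_subset hx)).1, hn.trans hq.n_le, ?_, ?_, hqE⟩
  · exact fun g₁ hg₁ g₂ hg₂ => hq.Γ_subset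
      (hΓ (Finset.mem_image.2 ⟨(g₁, g₂), Finset.mk_mem_product hg₁ hg₂, rfl⟩))
  · exact fun x hx g hg hg0 =>
      mem_iInter₂.1 (hbox (hq.box_subset hx)).2 g (Finset.mem_erase.2 ⟨hg0, hg⟩)

theorem extends_of_le {p : ℕ → Condition G C} (hp : ∀ k, (p (k + 1)).Extends (p k)) {i j : ℕ}
    (hij : i ≤ j) : (p j).Extends (p i) := by
  induction hij with
  | refl => exact Extends.refl _
  | step _ ih => exact (hp _).trans ih

/-- A decreasing sequence of conditions has a limit: a family of characters that satisfies all
constraints on a coordinate, from the stage on where the coordinate enters `F`. -/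
theorem exists_forall_mem_cell (p : ℕ → Condition G C) (hp : ∀ k, (p (k + 1)).Extends (p k))
    (b : C → ℕ → Bool) :
    ∃ ψ : C → (G →+ UnitAddCircle),
      ∀ α k, (∀ j, α ∈ (p j).F → α ∈ (p k).F) → ψ α ∈ (p k).cell b α := by
  have hmono {i j : ℕ} (hij : i ≤ j) := extends_of_le hp hij
  have : ∀ α, ∃ χ : G →+ UnitAddCircle,
      ∀ k, (∀ j, α ∈ (p j).F → α ∈ (p k).F) → χ ∈ (p k).cell b α := by
    intro α
    let K := {k // ∀ j, α ∈ (p j).F → α ∈ (p k).F}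
    have hK : Nonempty K := by
      by_cases h : ∃ j, α ∈ (p j).F
      · exact ⟨⟨h.choose, fun _ _ => h.choose_spec⟩⟩
      · exact ⟨⟨0, fun j hj => absurd ⟨j, hj⟩ h⟩⟩
    have hanti : ∀ k l : K, k.1 ≤ l.1 → (p l.1).cell b α ⊆ (p k.1).cell b α :=
      fun k l hkl => (hmono hkl).cell_subset b (k.2 l.1)
    obtain ⟨χ, hχ⟩ := IsCompact.nonempty_iInter_of_directed_nonempty_isCompact_isClosed
      (fun k : K => (p k.1).cell b α)
      (fun k l => (le_total k.1 l.1).elim (fun h => ⟨l, hanti k l h, subset_rfl⟩)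
        fun h => ⟨k, subset_rfl, hanti l k h⟩)
      (fun k => (p k.1).cell_nonempty b α) (fun k => ((p k.1).isClosed_cell b α).isCompact)
      fun k => (p k.1).isClosed_cell b α
    exact ⟨χ, fun k hk => mem_iInter.1 hχ ⟨k, hk⟩⟩
  choose ψ hψ using this
  exact ⟨ψ, hψ⟩

end Condition

/-- For a nonempty open set `W` and dense open sets `V n` there is a family `ψ` of characters in
`W ∩ ⋂ n, V n` all whose finite subfamilies map `E` to a dense set. Moreover, both properties
depend only on the restrictions of the characters to some countable subgroup `H`, and countably many
of the characters separate the points of `H`. -/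
theorem exists_generic_family [Infinite C] {E : Set G} (hinf : E.Infinite)
    (hE : ∀ d : ℕ, d ≠ 0 → ∀ g : G, {x ∈ E | d • x = g}.Finite)
    {b : C → ℕ → Bool} (hb : Function.Injective b)
    {W : Set (C → (G →+ UnitAddCircle))} (hW : IsOpen W) (hWne : W.Nonempty)
    {V : ℕ → Set (C → (G →+ UnitAddCircle))} (hV : ∀ n, IsOpen (V n)) (hVd : ∀ n, Dense (V n)) :
    ∃ (H : AddSubgroup G) (A : Set C) (ψ : C → (G →+ UnitAddCircle)), A.Countable ∧
      (∀ g ∈ H, g ≠ 0 → ∃ α ∈ A, ψ α g ≠ 0) ∧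
      ∀ x : C → (G →+ UnitAddCircle), (∀ α, ∀ g ∈ H, x α g = ψ α g) →
        x ∈ W ∧ (∀ n, x ∈ V n) ∧ ∀ (B : Finset C) (y : C → UnitAddCircle) (ε : ℝ), 0 < ε →
          ∃ e ∈ E, ∀ α ∈ B, dist (x α e) (y α) < ε := by
  classical
  obtain ⟨x₀, hx₀⟩ := hWne
  obtain ⟨F₀, Γ₀, r₀, hr₀, hbox₀⟩ := exists_box_subset hW hx₀
  let p₀ : Condition G C :=
    { F := F₀
      n := 0
      Γ := insert 0 Γ₀
      r := r₀
      r_pos := hr₀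
      atPoint := x₀
      atBranch := 0
      atBranch_congr := fun _ _ _ => rfl }
  choose next hnext hnextV hnextn hnextΓ hnext0 hnextE using
    fun (k : ℕ) (p : Condition G C) => p.exists_extends_step hinf hE b (hV k) (hVd k) k
  let p : ℕ → Condition G C := fun k => Nat.rec p₀ next k
  have hp : ∀ k, (p (k + 1)).Extends (p k) := fun k => hnext k (p k)
  have hmono {i j : ℕ} (hij : i ≤ j) := Condition.extends_of_le hp hij
  obtain ⟨ψ, hψ⟩ := Condition.exists_forall_mem_cell p hp b
  have hsub : ∀ g₁ g₂, (∃ k, g₁ ∈ (p k).Γ) → (∃ k, g₂ ∈ (p k).Γ) → ∃ k, g₁ - g₂ ∈ (p k).Γ := by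
    rintro g₁ g₂ ⟨k, hk⟩ ⟨l, hl⟩
    exact ⟨max k l + 1, hnextΓ _ _ g₁ ((hmono (le_max_left k l)).Γ_subset hk) g₂
      ((hmono (le_max_right k l)).Γ_subset hl)⟩
  have h0 : ∃ k, (0 : G) ∈ (p k).Γ := ⟨0, Finset.mem_insert_self 0 Γ₀⟩
  let H : AddSubgroup G := AddSubgroup.ofSub {g | ∃ k, g ∈ (p k).Γ} ⟨0, h0⟩
    fun g₁ h₁ g₂ h₂ => by simpa [sub_eq_add_neg] using hsub g₁ g₂ h₁ h₂
  have hψF : ∀ k, ∀ α ∈ (p k).F, ψ α ∈ (p k).cell b α := fun k α hα => hψ α k fun _ _ => hα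
  -- membership in the boxes only depends on the coordinates in `F`, and there only on `H`
  have hψbox : ∀ (k : ℕ) (x : C → (G →+ UnitAddCircle)),
      (∀ α ∈ (p k).F, ∀ g ∈ H, x α g = ψ α g) → x ∈ (p k).box := by
    intro k x hx α hα
    have := Condition.mem_cell_congr (fun g hg => hx α hα g ⟨k, hg⟩) (hψF k α hα)
    simpa [Condition.cell, hα] using this
  refine ⟨H, ⋃ k, (p k).F, ψ, countable_iUnion fun k => (p k).F.countable_toSet, ?_, ?_⟩
  · rintro g ⟨k, hk⟩ hg
    -- the coordinates outside `A` are set to zero, so that `g` is detected by one in `A`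
    obtain ⟨α, hα⟩ := hnext0 k (p k) (fun α => if α ∈ ⋃ k, ((p k).F : Set C) then ψ α else 0)
      (hψbox (k + 1) _ fun α hα g _ => by rw [if_pos (mem_iUnion.2 ⟨k + 1, hα⟩)]) g hk hg
    by_cases hαA : α ∈ ⋃ k, ((p k).F : Set C)
    · exact ⟨α, hαA, by simpa only [if_pos hαA] using hα⟩
    · simp only [if_neg hαA] at hα
      exact absurd (AddMonoidHom.zero_apply g) hα
  · intro x hx
    refine ⟨hbox₀ x fun α hα => ?_, fun n => hnextV n (p n) (hψbox (n + 1) x fun α _ => hx α),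
      fun B y ε hε => ?_⟩
    · exact charBall_mono (Finset.subset_insert _ _) le_rfl _ (hψbox 0 x (fun α _ => hx α) α hα)
    -- a stage at which all members of `B` that ever enter `F` have done so
    · obtain ⟨k₁, hk₁⟩ : ∃ k₁, ∀ α ∈ B, ∀ j, α ∈ (p j).F → α ∈ (p k₁).F := by
        have : ∀ α, ∃ k, ∀ j, α ∈ (p j).F → α ∈ (p k).F := by
          intro α
          by_cases h : ∃ j, α ∈ (p j).F
          · exact ⟨h.choose, fun _ _ => h.choose_spec⟩
          · exact ⟨0, fun j hj => absurd ⟨j, hj⟩ h⟩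
        choose k hk using this
        exact ⟨B.sup k, fun α hα j hj => (hmono (Finset.le_sup hα)).F_subset (hk α j hj)⟩
      -- a number of digits that distinguishes the members of `B`
      obtain ⟨k₂, hk₂⟩ : ∃ k₂, ∀ α ∈ B, ∀ β ∈ B, (∀ i < k₂, b α i = b β i) → α = β := by
        have : ∀ a : C × C, ∃ k, (∀ i < k, b a.1 i = b a.2 i) → a.1 = a.2 := by
          intro a
          by_cases h : b a.1 = b a.2
          · exact ⟨0, fun _ => hb h⟩
          · obtain ⟨i, hi⟩ := Function.ne_iff.1 h
            exact ⟨i + 1, fun h' => absurd (h' i i.lt_succ_self) hi⟩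
        choose k hk using this
        refine ⟨(B ×ˢ B).sup k, fun α hα β hβ h => hk (α, β) fun i hi => h i (hi.trans_le ?_)⟩
        exact Finset.le_sup (f := k) (Finset.mk_mem_product hα hβ)
      obtain ⟨k₃, hk₃⟩ := exists_nat_one_div_lt hε
      let k := max k₁ (max k₂ k₃)
      obtain ⟨e, he, h⟩ := hnextE k (p k) B x y
        (fun α hα => Condition.mem_cell_congr (fun g hg => hx α g ⟨k + 1, hg⟩)
          (hψ α (k + 1) fun j hj =>
            (hmono ((le_max_left _ _).trans k.le_succ)).F_subset (hk₁ α hα j hj)))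
        fun α hα β hβ _ _ h => hk₂ α hα β hβ fun i hi => h i (hi.trans_le
          (((le_max_left k₂ k₃).trans (le_max_right _ _)).trans (hnextn k (p k))))
      refine ⟨e, he, fun α hα => (h α hα).trans_le (le_trans ?_ hk₃.le)⟩
      exact Nat.one_div_le_one_div ((le_max_right k₂ k₃).trans (le_max_right _ _))

end Fusion

/-! ### Extending to the whole group -/

section Extension

variable {G : Type u} [AddCommGroup G] {C : Type v}

/-- A family of characters whose members indexed by the countable set `A` separate the points of `H`
can be changed outside `H` so as to separate the points of `G`: the members indexed by `A` are kept,
and the other ones are made to separate the points of the subgroup `M` on which the former vanish.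
This is possible since `M` meets `H` trivially. -/
theorem exists_separating_family (hC : ℵ₀ < #C)
    (hG : Cardinal.lift.{v} #G ≤ Cardinal.lift.{u} #(Set C)) (H : AddSubgroup G) {A : Set C}
    (hA : A.Countable) (ψ : C → (G →+ UnitAddCircle))
    (hψ : ∀ g ∈ H, g ≠ 0 → ∃ α ∈ A, ψ α g ≠ 0) :
    ∃ x : C → (G →+ UnitAddCircle), (∀ α, ∀ g ∈ H, x α g = ψ α g) ∧
      ∀ g, (∀ α, x α g = 0) → g = 0 := by
  classical
  have : Infinite C := Cardinal.infinite_iff.2 hC.le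
  have hAc : #(Aᶜ : Set C) = #C :=
    Cardinal.mk_compl_of_infinite A ((Cardinal.le_aleph0_iff_set_countable.2 hA).trans_lt hC)
  have : Infinite (Aᶜ : Set C) := Cardinal.infinite_iff.2 (hAc ▸ hC.le)
  let M : AddSubgroup G := ⨅ α ∈ A, (ψ α).ker
  have hM : ∀ g, g ∈ M ↔ ∀ α ∈ A, ψ α g = 0 := fun g => by
    simp [M, AddSubgroup.mem_iInf, AddMonoidHom.mem_ker]
  obtain ⟨f, hf⟩ := exists_injective_hom_of_le (M := M) (C := (Aᶜ : Set C)) (by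
    rw [Cardinal.mk_set, hAc, ← Cardinal.mk_set]
    exact (Cardinal.lift_le.2 (Cardinal.mk_subtype_le _)).trans hG)
  have hx : ∀ α, ∃ χ : G →+ UnitAddCircle, (∀ g ∈ H, χ g = ψ α g) ∧
      (α ∈ A → χ = ψ α) ∧ ∀ (h : α ∈ Aᶜ) (m : M), χ m = f m ⟨α, h⟩ := by
    intro α
    by_cases hα : α ∈ A
    · exact ⟨ψ α, fun _ _ => rfl, fun _ => rfl, fun h => absurd hα h⟩
    · obtain ⟨χ, hχ⟩ := exists_character_extension (M.subtype.coprod H.subtype)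
        (((Pi.evalAddMonoidHom (fun _ => UnitAddCircle) ⟨α, hα⟩).comp f).coprod
          ((ψ α).comp H.subtype)) (by
          rintro ⟨m, h⟩ hmh
          have hsum : (m : G) + h = 0 := hmh
          have hh : (h : G) = 0 := by
            by_contra hne
            obtain ⟨β, hβ, hne'⟩ := hψ h h.2 hne
            apply hne'
            rw [(neg_eq_of_add_eq_zero_right hsum).symm, map_neg, (hM m).1 m.2 β hβ, neg_zero]
          have hm : (m : G) = 0 := by simpa [hh] using hsum
          rw [AddMonoidHom.mem_ker, ZeroMemClass.coe_eq_zero.1 hh, ZeroMemClass.coe_eq_zero.1 hm]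
          exact map_zero _)
      refine ⟨χ, fun g hg => ?_, fun h => absurd h hα, fun _ m => ?_⟩
      · simpa using hχ (0, ⟨g, hg⟩)
      · simpa using hχ (m, 0)
  choose x hxH hxA hxM using hx
  refine ⟨x, hxH, fun g hg => ?_⟩
  have hgM : g ∈ M := (hM g).2 fun α hα => by rw [← hxA α hα]; exact hg α
  have : f ⟨g, hgM⟩ = f 0 := by
    ext α
    rw [← hxM α α.2, hg, map_zero, Pi.zero_apply]
  exact congrArg Subtype.val (hf this)

/-- Homomorphisms with dense image of `E` exist in the intersection of a nonempty open set with
countably many dense open sets, and they can be taken injective if `G` is not too large. -/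
theorem exists_hom_mem_denseHoms (hC : #C = 𝔠) {E : Set G} (hE : IsAlmostTorsion 0 E)
    {W : Set (G →+ (C → UnitAddCircle))} (hW : IsOpen W) (hWne : W.Nonempty)
    {V : ℕ → Set (G →+ (C → UnitAddCircle))} (hV : ∀ n, IsOpen (V n)) (hVd : ∀ n, Dense (V n)) :
    ∃ h ∈ W, (∀ n, h ∈ V n) ∧ h ∈ denseHoms E (C → UnitAddCircle) ∧
      (Cardinal.lift.{v} #G ≤ Cardinal.lift.{u} #(Set C) → Function.Injective h) := by
  have hC' : ℵ₀ < #C := hC ▸ Cardinal.aleph0_lt_continuum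
  have : Infinite C := Cardinal.infinite_iff.2 hC'.le
  obtain ⟨b, hb⟩ : ∃ b : C → ℕ → Bool, Function.Injective b := by
    have h : Cardinal.lift.{0} #C ≤ Cardinal.lift.{v} #(ℕ → Bool) := by
      simp [hC]
    obtain ⟨b⟩ := Cardinal.lift_mk_le'.1 h
    exact ⟨b, b.injective⟩
  let Φ := homPiHomeomorph G C
  obtain ⟨H, A, ψ, hA, hAH, hψ⟩ := exists_generic_family hE.infinite
    (fun d hd => hE.finite_fiber d ⟨hd, hd, dvd_zero d⟩) hb
    (hW.preimage Φ.symm.continuous) (hWne.preimage Φ.symm.surjective)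
    (fun n => (hV n).preimage Φ.symm.continuous)
    (fun n => (hVd n).preimage Φ.symm.isOpenMap)
  obtain ⟨x, hx, hinj⟩ : ∃ x : C → (G →+ UnitAddCircle), (∀ α, ∀ g ∈ H, x α g = ψ α g) ∧
      (Cardinal.lift.{v} #G ≤ Cardinal.lift.{u} #(Set C) → ∀ g, (∀ α, x α g = 0) → g = 0) := by
    by_cases hG : Cardinal.lift.{v} #G ≤ Cardinal.lift.{u} #(Set C)
    · obtain ⟨x, hx, hinj⟩ := exists_separating_family hC' hG H hA ψ hAH
      exact ⟨x, hx, fun _ => hinj⟩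
    · exact ⟨ψ, fun _ _ _ => rfl, fun h => absurd h hG⟩
  obtain ⟨hxW, hxV, hxE⟩ := hψ x hx
  refine ⟨Φ.symm x, hxW, hxV, ?_, fun hG => (injective_iff_map_eq_zero _).2 fun g hg =>
    hinj hG g fun α => congrFun hg α⟩
  refine dense_iff_inter_open.2 ?_
  rintro U hU ⟨y, hy⟩
  obtain ⟨B, t, ht, hsub⟩ := isOpen_pi_iff.1 hU y hy
  have : ∀ α : C, ∃ r > 0, α ∈ B → Metric.ball (y α) r ⊆ t α := by
    intro α
    by_cases hα : α ∈ B
    · obtain ⟨r, hr, h⟩ := Metric.isOpen_iff.1 (ht α hα).1 _ (ht α hα).2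
      exact ⟨r, hr, fun _ => h⟩
    · exact ⟨1, one_pos, fun h => absurd h hα⟩
  choose r hr hrt using this
  obtain ⟨ε, hε, hεr⟩ := exists_pos_forall_mem_le B hr
  obtain ⟨e, he, h⟩ := hxE B y ε hε
  exact ⟨Φ.symm x e, hsub fun α hα => hrt α hα ((h α hα).trans_le (hεr α hα)), e, he, rfl⟩

end Extension

/-! ### The Baire property, and the converse direction -/

/-- If `A` meets, inside every nonempty open set, every intersection of countably many dense open
subsets of `X`, then `A` is dense and a Baire space. -/
theorem isDenseBaire_of_forall_exists_mem {X : Type u} [TopologicalSpace X] {A : Set X}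
    (h : ∀ W : Set X, IsOpen W → W.Nonempty → ∀ V : ℕ → Set X, (∀ n, IsOpen (V n)) →
      (∀ n, Dense (V n)) → ∃ x ∈ W, (∀ n, x ∈ V n) ∧ x ∈ A) :
    IsDenseBaire A := by
  have hA : Dense A := dense_iff_inter_open.2 fun W hW hne => by
    obtain ⟨x, hx, -, hxA⟩ := h W hW hne (fun _ => univ) (fun _ => isOpen_univ)
      (fun _ => dense_univ)
    exact ⟨x, hx, hxA⟩
  refine ⟨hA, ⟨fun f hf hfd => dense_iff_inter_open.2 ?_⟩⟩
  rintro U hU ⟨u, hu⟩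
  obtain ⟨W, hW, rfl⟩ := isOpen_induced_iff.1 hU
  choose V hV hVf using fun n => isOpen_induced_iff.1 (hf n)
  obtain ⟨x, hxW, hxV, hxA⟩ := h W hW ⟨u, hu⟩ V hV fun n =>
    (hA.denseRange_val.dense_image continuous_subtype_val (hfd n)).mono (by
      rw [← hVf n]
      exact image_preimage_subset _ _)
  exact ⟨⟨x, hxA⟩, hxW, mem_iInter.2 fun n => hVf n ▸ hxV n⟩

section Converse

variable {G : Type u} [AddCommGroup G] {S : Set G}

/-- If no multiple `d! • S` is finite, choose `eₙ ∈ S` such that the elements `n! • eₙ` differ from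
`n! • eₘ` for all `m < n`. Then `d • eₘ ≠ d • eₙ` as soon as `m < n` and `1 ≤ d ≤ n`, since
`d` divides `n!`. -/
theorem exists_isAlmostTorsion_of_forall_infinite
    (hS : ∀ d : ℕ, d ≠ 0 → ((fun x => d • x) '' S).Infinite) :
    ∃ E ⊆ S, IsAlmostTorsion 0 E := by
  classical
  have hstep : ∀ (n : ℕ) (F : Finset G), ∃ e ∈ S, ∀ x ∈ F, n.factorial • x ≠ n.factorial • e := by
    intro n F
    obtain ⟨_, ⟨e, he, rfl⟩, hnot⟩ :=
      (hS _ n.factorial_ne_zero).exists_notMem_finset (F.image fun x => n.factorial • x)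
    exact ⟨e, he, fun x hx h => hnot (Finset.mem_image.2 ⟨x, hx, h⟩)⟩
  choose pick hpick hne using hstep
  -- `s n` is the set of the first `n` elements
  let s : ℕ → Finset G := fun n => Nat.rec ∅ (fun k F => insert (pick k F) F) n
  let e : ℕ → G := fun n => pick n (s n)
  have hes : ∀ m n, m < n → e m ∈ s n := by
    intro m n hmn
    induction hmn with
    | refl => exact Finset.mem_insert_self _ _
    | step _ ih => exact Finset.mem_insert_of_mem ih
  have hfact : ∀ m n, m < n → n.factorial • e m ≠ n.factorial • e n := fun m n hmn =>
    hne n (s n) _ (hes m n hmn)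
  have hinj : Function.Injective e := by
    intro m n hmn
    rcases lt_trichotomy m n with h | h | h
    · exact absurd (by rw [hmn]) (hfact m n h)
    · exact h
    · exact absurd (by rw [hmn]) (hfact n m h)
  refine ⟨range e, range_subset_iff.2 fun n => hpick _ _, infinite_range_of_injective hinj,
    countable_range e, fun x _ => zero_smul ℕ x, fun d hd g => ?_⟩
  have key : ∀ m n, m < n → d ≤ n → d • e m = g → d • e n ≠ g := by
    intro m n hmn hdn hm hn
    obtain ⟨c, hc⟩ := Nat.dvd_factorial (Nat.pos_of_ne_zero hd.1) hdn
    apply hfact m n hmn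
    rw [hc, mul_comm, mul_smul, mul_smul, hm, hn]
  have hsub : {n | d ≤ n ∧ d • e n = g}.Subsingleton := by
    rintro m ⟨hdm, hm⟩ n ⟨hdn, hn⟩
    by_contra hmn
    rcases lt_or_gt_of_ne hmn with h | h
    · exact key m n h hdn hm hn
    · exact key n m h hdm hn hm
  refine (((finite_lt_nat d).union hsub.finite).image e).subset ?_
  rintro _ ⟨⟨n, rfl⟩, hn⟩
  refine ⟨n, ?_, rfl⟩
  rcases lt_or_ge n d with h | h
  · exact Or.inl h
  · exact Or.inr ⟨h, hn⟩

theorem exists_isAlmostTorsion_of_nonempty_denseHoms {J : Type w} (hJ : 1 ≤ #J)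
    (h : (denseHoms S (J → UnitAddCircle)).Nonempty) : ∃ E ⊆ S, IsAlmostTorsion 0 E := by
  obtain ⟨j⟩ := Cardinal.mk_ne_zero_iff.1 (Cardinal.one_le_iff_ne_zero.1 hJ)
  obtain ⟨f, hf⟩ := h
  refine exists_isAlmostTorsion_of_forall_infinite fun d hd hfin => ?_
  -- the dense set `d • f(S)` in the circle would be finite
  have hsurj : Function.Surjective fun y : J → UnitAddCircle => d • y j := by
    intro t
    refine ⟨fun _ => DivisibleBy.div t (d : ℤ), ?_⟩
    have := DivisibleBy.div_cancel t (Int.natCast_ne_zero.2 hd)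
    rwa [natCast_zsmul] at this
  have hdense : Dense ((fun y : J → UnitAddCircle => d • y j) '' (f '' S)) :=
    hsurj.denseRange.dense_image ((continuous_nsmul d).comp (continuous_apply j)) hf
  have hfin' : ((fun y : J → UnitAddCircle => d • y j) '' (f '' S)).Finite := by
    refine (hfin.image fun g => f g j).subset ?_
    rintro _ ⟨_, ⟨x, hx, rfl⟩, rfl⟩
    exact ⟨d • x, ⟨x, hx, rfl⟩, by simp⟩
  have huniv : (univ : Set UnitAddCircle).Finite := by
    rwa [← hdense.closure_eq, hfin'.isClosed.closure_eq]
  have : Infinite (Ico (0 : ℝ) (0 + 1)) := (Ico_infinite (by norm_num)).to_subtype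
  have : Infinite UnitAddCircle := (AddCircle.equivIco (1 : ℝ) 0).infinite_iff.2 this
  exact infinite_univ huniv

/-- A homomorphism to `𝕋^C` with dense image of `S` gives, by projection, a homomorphism to the
one-dimensional torus indexed by any one-element type. -/
theorem nonempty_denseHoms_punit {C : Type v} [Nonempty C]
    (h : (denseHoms S (C → UnitAddCircle)).Nonempty) :
    (denseHoms S (PUnit.{w + 1} → UnitAddCircle)).Nonempty := by
  obtain ⟨f, hf⟩ := h
  obtain ⟨α⟩ := ‹Nonempty C›
  let π : (C → UnitAddCircle) →+ (PUnit.{w + 1} → UnitAddCircle) :=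
    AddMonoidHom.pi fun _ => Pi.evalAddMonoidHom (fun _ => UnitAddCircle) α
  have hπ : Continuous π := continuous_pi fun _ => continuous_apply α
  have hsurj : Function.Surjective π := fun y => ⟨fun _ => y ⟨⟩, rfl⟩
  refine ⟨π.comp f, ?_⟩
  have : Dense (π '' (f '' S)) := hsurj.denseRange.dense_image hπ hf
  rwa [image_image] at this

end Converse

end KroneckerWeyl

theorem mainTheorem2 {G : Type u} [AddCommGroup G] (S : Set G)
    {C : Type v} (hC : #C = 𝔠) :
    List.TFAE
      [∃ J : Type w, 1 ≤ #J ∧ (KroneckerWeyl.denseHoms S (J → UnitAddCircle)).Nonempty,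
       KroneckerWeyl.IsDenseBaire (KroneckerWeyl.denseHoms S (C → UnitAddCircle)),
       ∃ E : Set G, E ⊆ S ∧ KroneckerWeyl.IsAlmostTorsion 0 E] ∧
    (#G ≤ 2 ^ (𝔠 : Cardinal.{u}) →
      List.TFAE
        [∃ J : Type w, 1 ≤ #J ∧ (KroneckerWeyl.denseHoms S (J → UnitAddCircle)).Nonempty,
         KroneckerWeyl.IsDenseBaire (KroneckerWeyl.denseHoms S (C → UnitAddCircle)),
         ∃ E : Set G, E ⊆ S ∧ KroneckerWeyl.IsAlmostTorsion 0 E,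
         KroneckerWeyl.IsDenseBaire
           (KroneckerWeyl.denseHoms S (C → UnitAddCircle) ∩
             KroneckerWeyl.monoHoms G (C → UnitAddCircle))]) := by
  have hCne : Nonempty C := Cardinal.mk_ne_zero_iff.1 (hC ▸ Cardinal.continuum_ne_zero)
  have h13 : (∃ J : Type w, 1 ≤ #J ∧ (KroneckerWeyl.denseHoms S (J → UnitAddCircle)).Nonempty) →
      ∃ E : Set G, E ⊆ S ∧ KroneckerWeyl.IsAlmostTorsion 0 E := fun ⟨_, hJ, h⟩ =>
    KroneckerWeyl.exists_isAlmostTorsion_of_nonempty_denseHoms hJ h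
  have h1 : (KroneckerWeyl.denseHoms S (C → UnitAddCircle)).Nonempty →
      ∃ J : Type w, 1 ≤ #J ∧ (KroneckerWeyl.denseHoms S (J → UnitAddCircle)).Nonempty := fun h =>
    ⟨PUnit, by simp, KroneckerWeyl.nonempty_denseHoms_punit h⟩
  have h21 : KroneckerWeyl.IsDenseBaire (KroneckerWeyl.denseHoms S (C → UnitAddCircle)) →
      ∃ J : Type w, 1 ≤ #J ∧ (KroneckerWeyl.denseHoms S (J → UnitAddCircle)).Nonempty :=
    fun h => h1 h.1.nonempty
  have h32 : (∃ E : Set G, E ⊆ S ∧ KroneckerWeyl.IsAlmostTorsion 0 E) →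
      KroneckerWeyl.IsDenseBaire (KroneckerWeyl.denseHoms S (C → UnitAddCircle)) := by
    rintro ⟨E, hES, hE⟩
    refine KroneckerWeyl.isDenseBaire_of_forall_exists_mem fun W hW hne V hV hVd => ?_
    obtain ⟨h, hhW, hhV, hhE, -⟩ :=
      KroneckerWeyl.exists_hom_mem_denseHoms hC hE hW hne hV hVd
    exact ⟨h, hhW, hhV, hhE.mono (Set.image_mono hES)⟩
  refine ⟨?_, fun hG => ?_⟩
  · tfae_have 1 → 3 := h13
    tfae_have 3 → 2 := h32
    tfae_have 2 → 1 := h21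
    tfae_finish
  · have hG' : Cardinal.lift.{v} #G ≤ Cardinal.lift.{u} #(Set C) := by
      rw [Cardinal.mk_set, hC]
      simpa using Cardinal.lift_le.{v}.2 hG
    tfae_have 1 → 3 := h13
    tfae_have 3 → 2 := h32
    tfae_have 2 → 1 := h21
    tfae_have 4 → 1 := fun h => h1 (h.1.nonempty.mono Set.inter_subset_left)
    tfae_have 3 → 4 := by
      rintro ⟨E, hES, hE⟩
      refine KroneckerWeyl.isDenseBaire_of_forall_exists_mem fun W hW hne V hV hVd => ?_
      obtain ⟨h, hhW, hhV, hhE, hinj⟩ :=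
        KroneckerWeyl.exists_hom_mem_denseHoms hC hE hW hne hV hVd
      exact ⟨h, hhW, hhV, hhE.mono (Set.image_mono hES), hinj hG'⟩
    tfae_finish
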